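/- Let $\mathcal G$ be a finite directed graph without self-loops on $N$ agents, and let $\mathcal N_i$ be the set of neighbors sensed by agent $i$; the arcs of $\mathcal G$ point from $j$ to $i$ for $j\in\mathcal N_i$. Suppose $\mathcal G$ has a rooted-out branch, i.e. some node has directed paths to all other nodes. Let $a_{ij}>0$ and $l_{ij}>0$ for $j\in\mathcal N_i$, let $k_u>0$, and let $L_H$ be the weighted Laplacian, $(L_H)_{ii}=\sum_{j\in\mathcal N_i}a_{ij}$, $(L_H)_{ij}=-a_{ij}$ for $j\in\mathcal N_i$, and $(L_H)_{ij}=0$ otherwise. Let $C_i\in SO(3)$ be the (constant) orientation of the frame of agent $i$, let $C_{ji}=C_jC_i^{-1}$, let $p_1^*,\dots,p_N^*\in\mathbb R^3$ be the desired formation, and let $t_0\in\mathbb R$. On $[t_0,\infty)$ let the auxiliary variables $z_{i,1},z_{i,2}\in\mathbb R^3$ satisfy the orientation estimation law $$\dot z_{i,k}=\sum_{j\in\mathcal N_i}a_{ij}\bigl(C_{ji}^{-1}z_{j,k}-z_{i,k}\bigr),\qquad k=1,2.$$ Whenever $z_{i,1}(t),z_{i,2}(t)$ are linearly independent, let $\hat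 C_i(t)$ be the matrix with columns $b_{i,1},b_{i,2},b_{i,1}\times b_{i,2}$, where $b_{i,1},b_{i,2}$ are obtained from $z_{i,1}(t),z_{i,2}(t)$ by the Gram–Schmidt process. Let $\hat{\mathbf q}_k(t_0)\in\mathbb R^{3N}$ be the stacked vector of the $C_i^{-1}z_{i,k}(t_0)$, $i=1,\dots,N$. Suppose that neither $\hat{\mathbf q}_1(t_0)$ nor $\hat{\mathbf q}_2(t_0)$ lies in the column space of $L_H\otimes I_3$, and moreover that $\hat{\mathbf q}_2(t_0)-c\,\hat{\mathbf q}_1(t_0)$ does not lie in it for any $c\in\mathbb R$ (so $\hat{\mathbf q}_1(t_0),\hat{\mathbf q}_2(t_0)$ are linearly independent modulo this column space). Then there are a rotation $C^*\in SO(3)$, the same for all agents and all initial positions, such that $C_i^{-1}\hat C_i(t)\to C^*$ as $t\to\infty$ for all $i$, and constants $\lambda,K_1>0$, $K_2\ge 0$ with the following property. Let $p_1,\dots,p_N:[t_0,\infty)\to\mathbb R^3$ be any continuous positions (with arbitrary initial values) that follow the formation control law $\dot p_i=C_i^{-1}u_i^i$, $$u_i^i=k_u\sum_{j\in\mathcal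 N_i}l_{ij}\bigl(C_i(p_j-p_i)-\hat C_i(t)(p_j^*-p_i^*)\bigr),$$ at all instants $t\ge t_0$ at which $\hat C_i(t)$ is defined. Then there is a point $p_\infty\in\mathbb R^3$, the same for all agents, such that for all $i$ and all $t\ge t_0$ $$\|p_i(t)-(C^*p_i^*+p_\infty)\|\le\Bigl(K_1\sum_{j}\|p_j(t_0)-(C^*p_j^*+p_\infty)\|+K_2\Bigr)e^{-\lambda(t-t_0)}.$$ Here $\lambda$ and $K_1$ depend only on $\mathcal G$, the weights $a_{ij},l_{ij}$ and $k_u$, while $K_2$ may also depend on the $C_i$, the $p_i^*$, $t_0$ and the auxiliary variables, but not on the positions $p_i$. -/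

import Mathlib

open scoped Matrix Kronecker

namespace FormationControl

/-- Three-dimensional Euclidean space. -/
abbrev E3 : Type := EuclideanSpace ℝ (Fin 3)

/-- Application of a `3 × 3` real matrix to a vector of Euclidean space. -/
noncomputable def act (M : Matrix (Fin 3) (Fin 3) ℝ) (x : E3) : E3 :=
  WithLp.toLp 2 (M *ᵥ x.ofLp)

section Graph

variable {V : Type*} [Fintype V]

/-- The arcs of the interaction graph follow the flow of information: there is an arc from `j` to
`i` when agent `i` senses agent `j`, so the neighbors of `i` are the tails of its incoming arcs. -/
noncomputable def neighbors (G : Digraph V) (i : V) : Finset V :=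
  open Classical in Finset.univ.filter (fun j => G.Adj j i)

/-- Some node has directed paths to all other nodes. -/
def HasRootedOutBranch (G : Digraph V) : Prop :=
  ∃ r : V, ∀ i : V, Relation.ReflTransGen G.Adj r i

/-- The Laplacian of the digraph `G` with weights `a i j`, `j` a neighbor of `i`. -/
noncomputable def laplacian (G : Digraph V) (a : V → V → ℝ) : Matrix V V ℝ :=
  open Classical in Matrix.of fun i j =>
    if i = j then ∑ k ∈ neighbors G i, a i k
    else if j ∈ neighbors G i then -a i j else 0

/-- The column space of a square matrix. -/
def columnSpace {m : Type*} [Fintype m] (A : Matrix m m ℝ) : Submodule ℝ (m → ℝ) :=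
  Submodule.span ℝ (Set.range fun j => fun i => A i j)

/-- The orientation `C_{ji} = C_j C_i⁻¹` of frame `j` measured by agent `i`. -/
noncomputable def relOrientation (C : V → Matrix (Fin 3) (Fin 3) ℝ) (j i : V) :
    Matrix (Fin 3) (Fin 3) ℝ :=
  C j * (C i)⁻¹

/-- Orientation estimation law: the velocity of the auxiliary variable of agent `i`. -/
noncomputable def estimationLaw (G : Digraph V) (a : V → V → ℝ)
    (C : V → Matrix (Fin 3) (Fin 3) ℝ) (z : V → E3) (i : V) : E3 :=
  ∑ j ∈ neighbors G i, a i j • (act (relOrientation C j i)⁻¹ (z j) - z i)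

/-- First vector of the Gram–Schmidt process. -/
noncomputable def frameFst (z₁ : E3) : E3 := ‖z₁‖⁻¹ • z₁

/-- Second vector of the Gram–Schmidt process, before normalization. -/
noncomputable def gramSchmidtSnd (z₁ z₂ : E3) : E3 :=
  z₂ - (inner ℝ z₂ (frameFst z₁)) • frameFst z₁

/-- Second vector of the Gram–Schmidt process. -/
noncomputable def frameSnd (z₁ z₂ : E3) : E3 :=
  ‖gramSchmidtSnd z₁ z₂‖⁻¹ • gramSchmidtSnd z₁ z₂

/-- Cross product of the first two vectors. -/
noncomputable def frameTrd (z₁ z₂ : E3) : E3 :=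
  WithLp.toLp 2 (crossProduct (frameFst z₁).ofLp (frameSnd z₁ z₂).ofLp)

/-- The estimated orientation: the matrix with columns `b₁, b₂, b₁ × b₂`, where `b₁, b₂` come from
`z₁, z₂` by Gram–Schmidt. It is meaningful when `z₁, z₂` are linearly independent. -/
noncomputable def orientationEstimate (z₁ z₂ : E3) : Matrix (Fin 3) (Fin 3) ℝ :=
  Matrix.of fun r c => (![frameFst z₁, frameSnd z₁ z₂, frameTrd z₁ z₂] c) r

/-- Formation control law of agent `i` in its own frame, where the measured displacement of agent
`j` is `C_i (p_j - p_i)`; `Chat` is the estimated orientation of agent `i`. -/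
noncomputable def localControl (G : Digraph V) (l : V → V → ℝ) (ku : ℝ)
    (C : V → Matrix (Fin 3) (Fin 3) ℝ) (pstar : V → E3)
    (Chat : Matrix (Fin 3) (Fin 3) ℝ) (p : V → E3) (i : V) : E3 :=
  ku • ∑ j ∈ neighbors G i, l i j • (act (C i) (p j - p i) - act Chat (pstar j - pstar i))

/-- `z k i t` (`k = 0, 1`) are the auxiliary variables of agent `i` at time `t`; on `[t₀, ∞)` they
obey the orientation estimation law. -/
def IsEstimationTrajectory (G : Digraph V) (a : V → V → ℝ)
    (C : V → Matrix (Fin 3) (Fin 3) ℝ) (t₀ : ℝ) (z : Fin 2 → V → ℝ → E3) : Prop :=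
  ∀ k i t, t₀ ≤ t →
    HasDerivWithinAt (z k i) (estimationLaw G a C (fun j => z k j t) i) (Set.Ici t₀) t

/-- The positions `p i t` are continuous on `[t₀, ∞)` and move by the formation control law driven
by the orientation estimates. At an instant at which the two auxiliary variables of agent `i` are
linearly dependent the estimate of agent `i` is undefined, and nothing is asked of its velocity. -/
def IsFormationTrajectory (G : Digraph V) (l : V → V → ℝ) (ku : ℝ)
    (C : V → Matrix (Fin 3) (Fin 3) ℝ) (pstar : V → E3) (t₀ : ℝ)
    (z : Fin 2 → V → ℝ → E3) (p : V → ℝ → E3) : Prop :=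
  (∀ i, ContinuousOn (p i) (Set.Ici t₀)) ∧
  ∀ i t, t₀ ≤ t → LinearIndependent ℝ ![z 0 i t, z 1 i t] →
    HasDerivWithinAt (p i)
      (act (C i)⁻¹ (localControl G l ku C pstar
        (orientationEstimate (z 0 i t) (z 1 i t)) (fun j => p j t) i))
      (Set.Ici t₀) t

/-- The stacked vector `q = (C_1⁻¹ z_1, …, C_N⁻¹ z_N)`. -/
noncomputable def alignedState (C : V → Matrix (Fin 3) (Fin 3) ℝ) (z : V → E3) :
    V × Fin 3 → ℝ :=
  fun x => act (C x.1)⁻¹ (z x.1) x.2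

end Graph

end FormationControl

/-! In the aligned coordinates `q_i = C_i⁻¹ z_i` the estimation law is plain consensus `q' = -L q`.
The flow `exp (-tL)` is row-stochastic, and the root gives its time-one matrix a positive column, so
it contracts spreads; hence it converges exponentially to `1 wᵀ`, where `w` has sum one and spans
the left kernel of `L` (`exists_weight`). Each `q_{i,k}` therefore tends to the average `∑ w_j
q_{j,k}(t₀)`.

A stacked vector outside the column space of `L ⊗ I` has a nonzero `w`-average, by duality
(`weighted_sum_ne_zero_of_notMem_columnSpace`). So the two limits are linearly independent, and `C*`
is their Gram–Schmidt frame. That frame is rotation-equivariant and differentiable at independent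
pairs, so `C_i⁻¹ Ĉ_i → C*` exponentially (`exists_orientationEstimate_decay`).

In the error coordinates `p_i - C* p_i*` the control law is again consensus, for the weights `ku * l
i j`, with an exponentially small perturbation; variation of constants finishes
(`perturbed_consensus`).

One subtlety is that the estimates may be undefined at some instants. Since `q` is given by an
analytic formula whose limits are independent, these instants are countable
(`countable_not_linearIndependent`), and a mean value inequality for continuous functions ignores
countable sets. -/

namespace FormationControl

/-! ### The matrix flow `exp (-tL)`: semigroup law, derivative, analyticity. -/

section HeatKernel

variable {V : Type*} [Fintype V] [DecidableEq V]

/-- The flow of `x' = -L x`. -/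
noncomputable def heatKernel (L : Matrix V V ℝ) (t : ℝ) : Matrix V V ℝ :=
  NormedSpace.exp (t • (-L))

theorem heatKernel_zero (L : Matrix V V ℝ) : heatKernel L 0 = 1 := by
  simp [heatKernel, NormedSpace.exp_zero]

theorem heatKernel_add (L : Matrix V V ℝ) (s t : ℝ) :
    heatKernel L (s + t) = heatKernel L s * heatKernel L t := by
  unfold heatKernel
  rw [add_smul]
  exact Matrix.exp_add_of_commute _ _
    (((Commute.refl (-L)).smul_left s).smul_right t)

theorem heatKernel_natCast (L : Matrix V V ℝ) (n : ℕ) :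
    heatKernel L n = heatKernel L 1 ^ n := by
  induction n with
  | zero => simp [heatKernel_zero]
  | succ n ih => rw [Nat.cast_succ, heatKernel_add, ih, pow_succ]

open scoped Matrix.Norms.Operator in
theorem hasDerivAt_heatKernel_apply (L : Matrix V V ℝ) (t : ℝ) (i j : V) :
    HasDerivAt (fun s => heatKernel L s i j) (-(heatKernel L t * L) i j) t := by
  have h : HasDerivAt (heatKernel L) (heatKernel L t * -L) t :=
    hasDerivAt_exp_smul_const (𝕂 := ℝ) (-L) t
  have h2 := ((Matrix.entryLinearMap ℝ ℝ i j).toContinuousLinearMap.hasFDerivAt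
    (x := heatKernel L t)).comp_hasDerivAt t h
  simpa using! h2

open scoped Matrix.Norms.Operator in
theorem analyticAt_heatKernel_apply (L : Matrix V V ℝ) (t : ℝ) (i j : V) :
    AnalyticAt ℝ (fun s => heatKernel L s i j) t := by
  have h : AnalyticAt ℝ (heatKernel L) t := by
    have h1 : AnalyticAt ℝ (fun s : ℝ => s • (-L)) t := by fun_prop
    exact AnalyticAt.comp (f := fun s : ℝ => s • (-L))
      (NormedSpace.exp_analytic (𝕂 := ℝ) (t • (-L))) h1
  exact ((Matrix.entryLinearMap ℝ ℝ i j).toContinuousLinearMap.analyticAt _).comp h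

open scoped Matrix.Norms.Operator in
theorem hasSum_exp_apply (B : Matrix V V ℝ) (i j : V) :
    HasSum (fun n : ℕ => ((n.factorial : ℝ)⁻¹) * (B ^ n) i j) (NormedSpace.exp B i j) := by
  have h := NormedSpace.exp_series_hasSum_exp' (𝕂 := ℝ) B
  have h2 := h.mapL (Matrix.entryLinearMap ℝ ℝ i j).toContinuousLinearMap
  simpa using! h2

/-- Positivity of the flow comes from here: for large `c` the shifted matrix is entrywise
nonnegative, so its exponential series has nonnegative terms, and the scalar factor is positive. -/
theorem heatKernel_eq_exp_shift (L : Matrix V V ℝ) (c t : ℝ) :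
    heatKernel L t = Real.exp (-(t * c)) • NormedSpace.exp (t • (c • (1 : Matrix V V ℝ) - L)) := by
  have h1 : t • (-L) = (-(t * c)) • (1 : Matrix V V ℝ) + t • (c • (1 : Matrix V V ℝ) - L) := by
    rw [smul_sub, smul_smul, smul_neg, neg_smul]; abel
  have h2 : NormedSpace.exp ((-(t * c)) • (1 : Matrix V V ℝ))
      = Real.exp (-(t * c)) • (1 : Matrix V V ℝ) := by
    have h3 : (-(t * c)) • (1 : Matrix V V ℝ) = Matrix.diagonal fun _ => -(t * c) := by
      rw [Matrix.smul_one_eq_diagonal]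
    rw [h3, Matrix.exp_diagonal, Matrix.smul_one_eq_diagonal]
    congr 1
    funext i
    rw [Pi.coe_exp, Real.exp_eq_exp_ℝ]
  unfold heatKernel
  rw [h1, Matrix.exp_add_of_commute _ _ ((Commute.one_left _).smul_left _), h2, smul_mul_assoc,
    one_mul]

end HeatKernel

theorem tendsto_exp_decay {ρ : ℝ} (hρ : 0 < ρ) (t₀ : ℝ) :
    Filter.Tendsto (fun t : ℝ => Real.exp (-ρ * (t - t₀))) Filter.atTop (nhds 0) := by
  have h : Filter.Tendsto (fun t : ℝ => ρ * (t - t₀)) Filter.atTop Filter.atTop :=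
    (Filter.tendsto_atTop_add_const_right _ (-t₀) Filter.tendsto_id).const_mul_atTop hρ
  simpa [Function.comp_def, neg_mul] using Real.tendsto_exp_neg_atTop_nhds_zero.comp h

/-! ### Exponential convergence of the flow of a rooted Laplacian. -/

section Averaging

variable {V : Type*} [Fintype V] [DecidableEq V]

theorem heatKernel_mulVec_of_ker (L : Matrix V V ℝ) (x : V → ℝ) (hx : L *ᵥ x = 0) (t : ℝ) :
    heatKernel L t *ᵥ x = x := by
  have hd : ∀ i s, HasDerivAt (fun s => (heatKernel L s *ᵥ x) i) 0 s := fun i s => by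
    have h : HasDerivAt (fun s => ∑ j, heatKernel L s i j * x j)
        (∑ j, -(heatKernel L s * L) i j * x j) s :=
      HasDerivAt.fun_sum fun j _ => (hasDerivAt_heatKernel_apply L s i j).mul_const _
    have h0 : ∑ j, -(heatKernel L s * L) i j * x j = 0 := by
      have : ((heatKernel L s * L) *ᵥ x) i = 0 := by
        rw [← Matrix.mulVec_mulVec, hx]; simp
      simpa [Matrix.mulVec, dotProduct] using this
    rw [h0] at h
    exact h
  funext i
  have := is_const_of_deriv_eq_zero (fun s => (hd i s).differentiableAt)
    (fun s => (hd i s).deriv) t 0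
  simpa [heatKernel_zero] using this

theorem vecMul_heatKernel_of_ker (L : Matrix V V ℝ) (v : V → ℝ) (hv : v ᵥ* L = 0) (t : ℝ) :
    v ᵥ* heatKernel L t = v := by
  have h := heatKernel_mulVec_of_ker Lᵀ v (by rw [Matrix.mulVec_transpose, hv]) t
  have h2 : heatKernel Lᵀ t = (heatKernel L t)ᵀ := by
    unfold heatKernel
    rw [← Matrix.exp_transpose]
    simp
  rwa [h2, Matrix.mulVec_transpose] at h

omit [DecidableEq V] in
theorem matrix_mul_apply_nonneg {A B : Matrix V V ℝ}
    (hA : ∀ i j, 0 ≤ A i j) (hB : ∀ i j, 0 ≤ B i j) (i j : V) : 0 ≤ (A * B) i j := by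
  rw [Matrix.mul_apply]
  exact Finset.sum_nonneg fun k _ => mul_nonneg (hA _ _) (hB _ _)

theorem matrix_pow_apply_nonneg {A : Matrix V V ℝ}
    (hA : ∀ i j, 0 ≤ A i j) (n : ℕ) (i j : V) : 0 ≤ (A ^ n) i j := by
  induction n generalizing i j with
  | zero => rw [pow_zero, Matrix.one_apply]; split_ifs <;> simp
  | succ n ih => rw [pow_succ]; exact matrix_mul_apply_nonneg ih hA i j

theorem exp_apply_nonneg {A : Matrix V V ℝ}
    (hA : ∀ i j, 0 ≤ A i j) (i j : V) : 0 ≤ NormedSpace.exp A i j :=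
  (hasSum_exp_apply A i j).nonneg fun n =>
    mul_nonneg (by positivity) (matrix_pow_apply_nonneg hA n i j)

omit [DecidableEq V] in
/-- Contraction of the spread of a vector under a row-stochastic matrix with a positive column. -/
theorem stochastic_contracts {M : Matrix V V ℝ} (hM : ∀ i j, 0 ≤ M i j)
    (hrow : ∀ i, ∑ j, M i j = 1) {r : V} {δ : ℝ} (hδ : ∀ i, δ ≤ M i r)
    (x : V → ℝ) {m R : ℝ} (hx : ∀ i, x i ∈ Set.Icc m (m + R)) :
    ∃ m', ∀ i, (M *ᵥ x) i ∈ Set.Icc m' (m' + (1 - δ) * R) := by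
  have key : ∀ i (y : V → ℝ), (∀ j, 0 ≤ y j) → δ * y r ≤ (M *ᵥ y) i := fun i y hy => by
    calc δ * y r ≤ M i r * y r := mul_le_mul_of_nonneg_right (hδ i) (hy r)
      _ ≤ ∑ j, M i j * y j := Finset.single_le_sum (f := fun j => M i j * y j)
        (fun j _ => mul_nonneg (hM i j) (hy j)) (Finset.mem_univ r)
  -- Every row puts mass at least `δ` on `x r`, which pulls both ends of the interval towards `x r`:
  -- `key` for `x - m` raises the lower end, `key` for `m + R - x` lowers the upper one.
  refine ⟨m + δ * (x r - m), fun i => ⟨?_, ?_⟩⟩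
  · have h := key i (fun j => x j - m) (fun j => sub_nonneg.2 (hx j).1)
    have e : (M *ᵥ fun j => x j - m) i = (M *ᵥ x) i - m := by
      simp only [Matrix.mulVec, dotProduct, mul_sub, Finset.sum_sub_distrib]
      rw [← Finset.sum_mul, hrow, one_mul]
    rw [e] at h; linarith
  · have h := key i (fun j => m + R - x j) (fun j => sub_nonneg.2 (hx j).2)
    have e : (M *ᵥ fun j => m + R - x j) i = m + R - (M *ᵥ x) i := by
      simp only [Matrix.mulVec, dotProduct, mul_sub, Finset.sum_sub_distrib]
      rw [← Finset.sum_mul, hrow, one_mul]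
    rw [e] at h; linarith

/-- A matrix with nonpositive off-diagonal entries and vanishing row sums, in whose digraph some
vertex reaches every other one. -/
structure IsRootedLaplacian (L : Matrix V V ℝ) : Prop where
  off_diag : ∀ i j, i ≠ j → L i j ≤ 0
  row_sum : ∀ i, ∑ j, L i j = 0
  root : ∃ r, ∀ i, Relation.ReflTransGen (fun j i => L i j < 0) r i

namespace IsRootedLaplacian

variable {L : Matrix V V ℝ}

omit [DecidableEq V] in
theorem mulVec_one (hL : IsRootedLaplacian L) : L *ᵥ (fun _ => 1) = 0 := by
  funext i; simpa [Matrix.mulVec, dotProduct] using hL.row_sum i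

theorem heatKernel_row_sum (hL : IsRootedLaplacian L) (t : ℝ) (i : V) :
    ∑ j, heatKernel L t i j = 1 := by
  have := congrFun (heatKernel_mulVec_of_ker L _ hL.mulVec_one t) i
  simpa [Matrix.mulVec, dotProduct] using this

/-- Shift that makes `c • 1 - L` entrywise positive on the diagonal. -/
theorem exists_shift (hL : IsRootedLaplacian L) :
    ∃ c : ℝ, (∀ i j, 0 ≤ (c • (1 : Matrix V V ℝ) - L) i j) ∧
      ∀ i j, L i j < 0 → 0 < (c • (1 : Matrix V V ℝ) - L) i j := by
  have hs : ∀ i, 0 ≤ ∑ k, |L k k| - L i i := fun i => by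
    have := Finset.single_le_sum (f := fun k => |L k k|) (fun k _ => abs_nonneg _)
      (Finset.mem_univ i)
    have h2 := le_abs_self (L i i)
    linarith
  refine ⟨∑ k, |L k k|, fun i j => ?_, fun i j hij => ?_⟩
  · by_cases h : i = j
    · subst h; simpa using hs i
    · simpa [Matrix.one_apply, h] using hL.off_diag i j h
  · by_cases h : i = j
    · subst h
      have := hs i
      have h3 : 0 ≤ ∑ k, |L k k| := Finset.sum_nonneg fun k _ => abs_nonneg _
      simp; linarith
    · simpa [Matrix.one_apply, h] using hij

theorem heatKernel_nonneg (hL : IsRootedLaplacian L) {t : ℝ} (ht : 0 ≤ t) (i j : V) :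
    0 ≤ heatKernel L t i j := by
  obtain ⟨c, hc, -⟩ := hL.exists_shift
  rw [heatKernel_eq_exp_shift L c]
  exact mul_nonneg (Real.exp_pos _).le
    (exp_apply_nonneg (fun i j => mul_nonneg ht (hc i j)) i j)

theorem heatKernel_le_one (hL : IsRootedLaplacian L) {t : ℝ} (ht : 0 ≤ t) (i j : V) :
    heatKernel L t i j ≤ 1 := by
  rw [← hL.heatKernel_row_sum t i]
  exact Finset.single_le_sum (fun k _ => hL.heatKernel_nonneg ht i k) (Finset.mem_univ j)

/-- A whole column of the time-one flow is positive. -/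
theorem exists_heatKernel_one_pos (hL : IsRootedLaplacian L) :
    ∃ r, ∀ i, 0 < heatKernel L 1 i r := by
  obtain ⟨r, hr⟩ := hL.root
  obtain ⟨c, hc, hc'⟩ := hL.exists_shift
  refine ⟨r, fun i => ?_⟩
  -- A path of `n` arcs from `r` to `i` contributes a positive product to this entry of the `n`-th
  -- power.
  have hpow : ∃ n : ℕ, 0 < ((c • (1 : Matrix V V ℝ) - L) ^ n) i r := by
    induction hr i with
    | refl => exact ⟨0, by simp⟩
    | @tail j k _ hjk ih =>
      obtain ⟨n, hn⟩ := ih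
      refine ⟨n + 1, ?_⟩
      rw [pow_succ', Matrix.mul_apply]
      exact Finset.sum_pos' (fun m _ => mul_nonneg (hc _ _) (matrix_pow_apply_nonneg hc n _ _))
        ⟨j, Finset.mem_univ j, mul_pos (hc' _ _ hjk) hn⟩
  obtain ⟨n, hn⟩ := hpow
  rw [heatKernel_eq_exp_shift L c, one_smul]
  refine mul_pos (Real.exp_pos _) ?_
  refine lt_of_lt_of_le (mul_pos (by positivity) hn)
    (le_hasSum (hasSum_exp_apply (c • (1 : Matrix V V ℝ) - L) i r) n fun m _ =>
      mul_nonneg (by positivity) (matrix_pow_apply_nonneg hc m i r))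

/-- Exponential decay of the spread of the columns of the flow. -/
theorem exists_spread_le (hL : IsRootedLaplacian L) :
    ∃ K rate : ℝ, 0 < K ∧ 0 < rate ∧ ∀ t, 0 ≤ t → ∀ i k j,
      |heatKernel L t i j - heatKernel L t k j| ≤ K * Real.exp (-rate * t) := by
  obtain ⟨r, hr⟩ := hL.exists_heatKernel_one_pos
  obtain ⟨i₀, -, hi₀⟩ := Finset.exists_min_image Finset.univ (fun i => heatKernel L 1 i r)
    ⟨r, Finset.mem_univ r⟩
  set δ := heatKernel L 1 i₀ r with hδ
  have hδ0 : 0 < δ := hr i₀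
  have hδ1 : δ ≤ 1 := hL.heatKernel_le_one zero_le_one _ _
  have iter : ∀ (n : ℕ) (x : V → ℝ), (∀ i, x i ∈ Set.Icc (0 : ℝ) 1) →
      ∃ m, ∀ i, ((heatKernel L 1 ^ n) *ᵥ x) i ∈ Set.Icc m (m + (1 - δ) ^ n) := by
    intro n x hx
    induction n with
    | zero => exact ⟨0, by simpa using hx⟩
    | succ n ih =>
      obtain ⟨m, hm⟩ := ih
      obtain ⟨m', hm'⟩ := stochastic_contracts (hL.heatKernel_nonneg zero_le_one)
        (hL.heatKernel_row_sum 1) (fun i => hi₀ i (Finset.mem_univ i)) _ hm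
      refine ⟨m', fun i => ?_⟩
      rw [pow_succ' (heatKernel L 1), ← Matrix.mulVec_mulVec, pow_succ']
      exact hm' i
  -- Only `n = ⌊t⌋₊ > t - 1` whole time units contract; the factor `exp δ` pays for the missing
  -- fraction.
  refine ⟨Real.exp δ, δ, Real.exp_pos _, hδ0, fun t ht i k j => ?_⟩
  have hfl := Nat.floor_le ht
  have hfl' := Nat.lt_floor_add_one t
  set n := ⌊t⌋₊
  -- The flow over the fractional time goes first: its columns have entries in `[0, 1]`, and the
  -- time-one flow then acts on them `n` times.
  obtain ⟨m, hm⟩ := iter n (fun k => heatKernel L (t - n) k j) (fun k =>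
    ⟨hL.heatKernel_nonneg (sub_nonneg.2 hfl) _ _, hL.heatKernel_le_one (sub_nonneg.2 hfl) _ _⟩)
  have e : ∀ i, ((heatKernel L 1 ^ n) *ᵥ fun k => heatKernel L (t - n) k j) i
      = heatKernel L t i j := fun i => by
    have : heatKernel L t = heatKernel L 1 ^ n * heatKernel L (t - n) := by
      rw [← heatKernel_natCast, ← heatKernel_add]; congr 1; ring
    rw [this, Matrix.mul_apply]; rfl
  have hi := hm i
  have hk := hm k
  rw [e] at hi hk
  have hb : (1 - δ) ^ n ≤ Real.exp δ * Real.exp (-δ * t) := by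
    calc (1 - δ) ^ n ≤ Real.exp (-δ) ^ n :=
          pow_le_pow_left₀ (by linarith) (Real.one_sub_le_exp_neg δ) n
      _ = Real.exp (n * (-δ)) := (Real.exp_nat_mul _ _).symm
      _ ≤ Real.exp (δ + -δ * t) := Real.exp_le_exp.2 (by nlinarith)
      _ = _ := Real.exp_add _ _
  rw [abs_le]
  constructor <;> linarith [hi.1, hi.2, hk.1, hk.2]

/-- The flow of a rooted Laplacian converges exponentially to the averaging operator of a weight
vector, which spans the left kernel. -/
theorem exists_weight (hL : IsRootedLaplacian L) :
    ∃ w : V → ℝ, ∑ i, w i = 1 ∧ w ᵥ* L = 0 ∧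
      (∀ v : V → ℝ, v ᵥ* L = 0 → ∀ j, v j = (∑ i, v i) * w j) ∧
      ∃ K rate : ℝ, 0 < K ∧ 0 < rate ∧ ∀ t, 0 ≤ t → ∀ i j,
        |heatKernel L t i j - w j| ≤ K * Real.exp (-rate * t) := by
  obtain ⟨K, rate, hK, hrate, hsp⟩ := hL.exists_spread_le
  have conv : ∀ v : V → ℝ, v ᵥ* L = 0 → ∀ t, 0 ≤ t → ∀ i j,
      |(∑ k, v k) * heatKernel L t i j - v j| ≤ (∑ k, |v k|) * (K * Real.exp (-rate * t)) := by
    intro v hv t ht i j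
    -- The flow fixes the left-kernel vector `v`, so `v j` is a combination of the `j`-th column
    -- with coefficients `v k`, and only differences within that column remain.
    have e : (∑ k, v k) * heatKernel L t i j - v j
        = ∑ k, v k * (heatKernel L t i j - heatKernel L t k j) := by
      have h := congrFun (vecMul_heatKernel_of_ker L v hv t) j
      simp only [Matrix.vecMul, dotProduct] at h
      simp only [mul_sub, Finset.sum_sub_distrib, ← Finset.sum_mul, h]
    rw [e, Finset.sum_mul]
    refine (Finset.abs_sum_le_sum_abs _ _).trans (Finset.sum_le_sum fun k _ => ?_)
    rw [abs_mul]
    exact mul_le_mul_of_nonneg_left (hsp t ht _ _ _) (abs_nonneg _)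
  have lim : Filter.Tendsto (fun t : ℝ => Real.exp (-rate * t)) Filter.atTop (nhds 0) := by
    simpa using tendsto_exp_decay hrate 0
  have tend : ∀ v : V → ℝ, v ᵥ* L = 0 → ∀ i j, Filter.Tendsto
      (fun t => (∑ k, v k) * heatKernel L t i j) Filter.atTop (nhds (v j)) := by
    intro v hv i j
    rw [tendsto_iff_norm_sub_tendsto_zero]
    refine squeeze_zero' (.of_forall fun t => norm_nonneg _)
      (Filter.eventually_ge_atTop 0 |>.mono fun t ht => conv v hv t ht i j) ?_
    simpa using (lim.const_mul K).const_mul (∑ k, |v k|)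
  obtain ⟨r, hr⟩ := hL.root
  obtain ⟨v, hv0, hv⟩ : ∃ v : V → ℝ, v ≠ 0 ∧ v ᵥ* L = 0 :=
    Matrix.exists_vecMul_eq_zero_iff.2 (Matrix.exists_mulVec_eq_zero_iff.1
      ⟨fun _ => 1, fun h => one_ne_zero (congrFun h r), hL.mulVec_one⟩)
  -- With zero sum, the functions in `tend` vanish identically, which forces their limits `v j` to
  -- be zero.
  have hs : ∑ k, v k ≠ 0 := by
    intro hs
    refine hv0 (funext fun j => ?_)
    have := tend v hv r j
    simp only [hs, zero_mul] at this
    exact tendsto_nhds_unique this tendsto_const_nhds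
  have hw : ((∑ k, v k)⁻¹ • v) ᵥ* L = 0 := by rw [Matrix.smul_vecMul, hv, smul_zero]
  have hw1 : ∑ k, ((∑ k, v k)⁻¹ • v) k = 1 := by
    simp only [Pi.smul_apply, smul_eq_mul, ← Finset.mul_sum]
    exact inv_mul_cancel₀ hs
  set w := (∑ k, v k)⁻¹ • v
  refine ⟨w, hw1, hw, fun u hu j => ?_, (∑ k, |w k|) * K, rate, mul_pos ?_ hK, hrate,
    fun t ht i j => ?_⟩
  · have h1 := tend u hu r j
    have h2 := (tend w hw r j).const_mul (∑ k, u k)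
    simp only [hw1, one_mul] at h2
    exact tendsto_nhds_unique h1 h2
  · refine lt_of_lt_of_le zero_lt_one ?_
    rw [← hw1]
    exact Finset.sum_le_sum fun k _ => le_abs_self _
  · have := conv w hw t ht i j
    rwa [hw1, one_mul, ← mul_assoc] at this

end IsRootedLaplacian

end Averaging

/-! ### A mean value inequality ignoring countably many instants. -/

section MeanValue

variable {E : Type*} [NormedAddCommGroup E] [NormedSpace ℝ E] [CompleteSpace E]

/-- Mean value inequality for a continuous function that is differentiable off a countable set. -/
theorem norm_sub_le_of_hasDerivAt_off_countable {f f' : ℝ → E} {B B' : ℝ → ℝ} {a b : ℝ}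
    (hab : a ≤ b) {S : Set ℝ} (hS : S.Countable) (hc : ContinuousOn f (Set.Icc a b))
    (hf : ∀ x ∈ Set.Ioo a b \ S, HasDerivAt f (f' x) x)
    (hB : ∀ x, HasDerivAt B (B' x) x) (hB' : Continuous B')
    (hle : ∀ x ∈ Set.Ioo a b \ S, ‖f' x‖ ≤ B' x) :
    ‖f b - f a‖ ≤ B b - B a := by
  have hint : IntervalIntegrable B' MeasureTheory.volume a b := hB'.intervalIntegrable a b
  have hae : ∀ᵐ x ∂MeasureTheory.volume, x ∈ Set.Ioc a b → ‖deriv f x‖ ≤ B' x := by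
    have hS' : (S ∪ {b}).Countable := hS.union (Set.countable_singleton b)
    filter_upwards [hS'.ae_notMem MeasureTheory.volume] with x hx hxab
    have hx' : x ∈ Set.Ioo a b \ S :=
      ⟨⟨hxab.1, lt_of_le_of_ne hxab.2 fun h => hx (Or.inr h)⟩, fun h => hx (Or.inl h)⟩
    rw [(hf x hx').deriv]
    exact hle x hx'
  -- The almost-everywhere bound by the continuous `B'` supplies the integrability that the
  -- fundamental theorem off a countable set requires.
  have hint' : IntervalIntegrable (deriv f) MeasureTheory.volume a b := by
    refine hint.mono_fun (aestronglyMeasurable_deriv f _) ?_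
    rw [Set.uIoc_of_le hab]
    filter_upwards [MeasureTheory.ae_restrict_mem measurableSet_Ioc,
      MeasureTheory.ae_restrict_of_ae hae] with x hx hxle
    exact (hxle hx).trans (le_abs_self _)
  have h1 : ∫ x in a..b, deriv f x = f b - f a :=
    MeasureTheory.integral_eq_of_hasDerivAt_off_countable_of_le f (deriv f) hab hS hc
      (fun x hx => by rw [(hf x hx).deriv]; exact hf x hx) hint'
  have h2 : ∫ x in a..b, B' x = B b - B a :=
    intervalIntegral.integral_eq_sub_of_hasDerivAt (fun x _ => hB x) hint
  rw [← h1, ← h2]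
  exact intervalIntegral.norm_integral_le_of_norm_le hab hae hint

end MeanValue

/-! ### Consensus dynamics in a normed space, with and without perturbation. -/

section Consensus

variable {V : Type*} [Fintype V] {E : Type*} [NormedAddCommGroup E] [NormedSpace ℝ E]

theorem sum_smul_sum_smul (L : Matrix V V ℝ) (h : V → ℝ) (x : V → E) :
    ∑ j, h j • ∑ k, L j k • x k = ∑ k, (h ᵥ* L) k • x k := by
  simp only [Matrix.vecMul, dotProduct, Finset.smul_sum, Finset.sum_smul, smul_smul]
  exact Finset.sum_comm

variable [DecidableEq V]

/-- The derivative `H(t - s) L` of the kernel `H = heatKernel L` cancels the drift `-L x`, leaving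
only the perturbation. Subtracting `u` is free because `u L = 0`: `u = 0` gives variation of
constants, while `u = w` gives a decaying kernel. -/
theorem hasDerivAt_heatKernel_transport (L : Matrix V V ℝ) {u : V → ℝ} (hu : u ᵥ* L = 0)
    {x : V → ℝ → E} {d : V → E} {s : ℝ}
    (hx : ∀ j, HasDerivAt (x j) (-(∑ k, L j k • x k s) + d j) s) (t : ℝ) (i : V) :
    HasDerivAt (fun s => ∑ j, (heatKernel L (t - s) i j - u j) • x j s)
      (∑ j, (heatKernel L (t - s) i j - u j) • d j) s := by
  have hH : ∀ j, HasDerivAt (fun s => heatKernel L (t - s) i j - u j)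
      ((heatKernel L (t - s) * L) i j) s := fun j => by
    have h1 : HasDerivAt (fun s : ℝ => t - s) (-1) s := by
      simpa using (hasDerivAt_id s).const_sub t
    have := (hasDerivAt_heatKernel_apply L (t - s) i j).scomp s h1
    simpa [Function.comp_def] using this.sub_const (u j)
  have h := HasDerivAt.fun_sum (u := Finset.univ) fun j _ => (hH j).smul (hx j)
  convert! h using 1
  have e1 := sum_smul_sum_smul L (fun j => heatKernel L (t - s) i j - u j) (fun k => x k s)
  have e2 : (fun j => heatKernel L (t - s) i j - u j) ᵥ* L
      = fun k => (heatKernel L (t - s) * L) i k := by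
    have : (fun j => heatKernel L (t - s) i j - u j) = heatKernel L (t - s) i - u := rfl
    rw [this, Matrix.sub_vecMul, hu, sub_zero]
    rfl
  rw [e2] at e1
  simp only [smul_add, smul_neg, Finset.sum_add_distrib, Finset.sum_neg_distrib, e1]
  abel

variable [CompleteSpace E]

/-- Variation of constants for the unperturbed consensus dynamics. -/
theorem consensus_eq_heatKernel (L : Matrix V V ℝ) {x : V → ℝ → E} {t₀ : ℝ}
    (hc : ∀ i, ContinuousOn (x i) (Set.Ici t₀))
    (hx : ∀ i t, t₀ < t → HasDerivAt (x i) (-(∑ k, L i k • x k t)) t)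
    (i : V) {t : ℝ} (ht : t₀ ≤ t) :
    x i t = ∑ j, heatKernel L (t - t₀) i j • x j t₀ := by
  have hF := fun s (hs : s ∈ Set.Ioo t₀ t \ ∅) =>
    hasDerivAt_heatKernel_transport L (Matrix.zero_vecMul L) (x := x) (d := fun _ => 0)
      (fun j => by simpa using hx j s hs.1.1) t i
  have hcont : ContinuousOn (fun s => ∑ j, (heatKernel L (t - s) i j - (0 : V → ℝ) j) • x j s)
      (Set.Icc t₀ t) := by
    refine continuousOn_finsetSum _ fun j _ => ContinuousOn.smul (Continuous.continuousOn ?_)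
      ((hc j).mono Set.Icc_subset_Ici_self)
    have : Continuous fun s => heatKernel L s i j := continuous_iff_continuousAt.2 fun s =>
      (hasDerivAt_heatKernel_apply L s i j).continuousAt
    fun_prop
  have h := norm_sub_le_of_hasDerivAt_off_countable ht Set.countable_empty hcont hF
    (B := fun _ => 0) (B' := fun _ => 0) (fun s => hasDerivAt_const s 0) continuous_const
    (fun s _ => by simp)
  rw [sub_zero, norm_le_zero_iff, sub_eq_zero] at h
  simpa [heatKernel_zero, Matrix.one_apply] using h

theorem hasDerivAt_const_mul_exp_affine (A c b x : ℝ) (hc : c ≠ 0) :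
    HasDerivAt (fun s => A / c * Real.exp (c * s + b)) (A * Real.exp (c * x + b)) x := by
  have h1 : HasDerivAt (fun s : ℝ => c * s + b) c x := by
    simpa using ((hasDerivAt_id x).const_mul c).add_const b
  have h := h1.exp.const_mul (A / c)
  convert! h using 1
  field_simp

/-- Consensus dynamics with an exponentially decaying perturbation, whose velocities are
prescribed off a countable set of instants, reach a common limit exponentially fast. -/
theorem perturbed_consensus {L : Matrix V V ℝ} {w : V → ℝ} (hw1 : ∑ i, w i = 1)
    (hwL : w ᵥ* L = 0) {K ρ μ D : ℝ} (hK : 0 ≤ K) (hμ : 0 < μ) (hμρ : μ < ρ)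
    (hrow : ∀ t i, ∑ j, heatKernel L t i j = 1)
    (hH : ∀ t, 0 ≤ t → ∀ i j, |heatKernel L t i j - w j| ≤ K * Real.exp (-ρ * t))
    {S : Set ℝ} (hS : S.Countable) {t₀ : ℝ} {x : V → ℝ → E} {d : V → ℝ → E}
    (hc : ∀ i, ContinuousOn (x i) (Set.Ici t₀))
    (hx : ∀ i t, t₀ < t → t ∉ S → HasDerivAt (x i) (-(∑ k, L i k • x k t) + d i t) t)
    (hd : ∀ i t, t₀ < t → ‖d i t‖ ≤ D * Real.exp (-μ * (t - t₀))) :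
    ∃ xinf : E, ∀ i t, t₀ ≤ t → ‖x i t - xinf‖ ≤
      (K * ∑ j, ‖x j t₀ - xinf‖ + ((∑ j, |w j|) / μ + Fintype.card V * K / (ρ - μ)) * D)
        * Real.exp (-μ * (t - t₀)) := by
  set W := ∑ j, |w j|
  -- The coupling drops out of the `w`-average because `w L = 0`. It moves only by the perturbation,
  -- whose bound is integrable, so it converges; its limit is the consensus point.
  set y : ℝ → E := fun t => ∑ j, w j • x j t with hy
  have hyc : ContinuousOn y (Set.Ici t₀) :=
    continuousOn_finsetSum _ fun j _ => (hc j).const_smul _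
  have hyd : ∀ t, t₀ < t → t ∉ S → HasDerivAt y (∑ j, w j • d j t) t := fun t ht htS => by
    have h := HasDerivAt.fun_sum (u := Finset.univ) fun j _ => (hx j t ht htS).const_smul (w j)
    convert! h using 1
    simp only [smul_add, smul_neg, Finset.sum_add_distrib, Finset.sum_neg_distrib,
      sum_smul_sum_smul, hwL]
    simp
  have hwd : ∀ t, t₀ < t → ‖∑ j, w j • d j t‖ ≤ W * D * Real.exp (-μ * t + μ * t₀) :=
    fun t ht => by
      refine (norm_sum_le _ _).trans ?_
      rw [mul_assoc, Finset.sum_mul]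
      refine Finset.sum_le_sum fun j _ => ?_
      rw [norm_smul, Real.norm_eq_abs]
      refine mul_le_mul_of_nonneg_left ((hd j t ht).trans_eq ?_) (abs_nonneg _)
      ring_nf
  have hyb : ∀ s t, t₀ ≤ s → s ≤ t →
      ‖y t - y s‖ ≤ W * D / μ * Real.exp (-μ * (s - t₀))
        - W * D / μ * Real.exp (-μ * (t - t₀)) := fun s t hs hst => by
    have h := norm_sub_le_of_hasDerivAt_off_countable hst hS
      (hyc.mono fun r hr => hs.trans hr.1)
      (fun r hr => hyd r (hs.trans_lt hr.1.1) hr.2)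
      (fun r => hasDerivAt_const_mul_exp_affine (W * D) (-μ) (μ * t₀) r (by linarith))
      (by fun_prop) (fun r hr => hwd r (hs.trans_lt hr.1.1))
    refine h.trans_eq ?_
    have e : ∀ r, -μ * r + μ * t₀ = -μ * (r - t₀) := fun r => by ring
    rw [e, e, div_neg]; ring
  have hlim : Filter.Tendsto (fun t : ℝ => W * D / μ * Real.exp (-μ * (t - t₀))) Filter.atTop
      (nhds 0) := by
    simpa using (tendsto_exp_decay hμ t₀).const_mul (W * D / μ)
  have hcauchy : CauchySeq y := by
    refine Metric.cauchySeq_iff'.2 fun ε hε => ?_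
    obtain ⟨N, hN⟩ := Filter.eventually_atTop.1
      ((hlim.eventually (Metric.ball_mem_nhds 0 (half_pos hε))).and
        (Filter.eventually_ge_atTop t₀))
    refine ⟨N, fun n hn => ?_⟩
    have h1 := abs_lt.1 (mem_ball_zero_iff.1 (hN n hn).1)
    have h2 := abs_lt.1 (mem_ball_zero_iff.1 (hN N le_rfl).1)
    rw [dist_eq_norm]
    linarith [hyb N n (hN N le_rfl).2 hn]
  obtain ⟨xinf, hxinf⟩ := cauchySeq_tendsto_of_complete hcauchy
  have hyinf : ∀ t, t₀ ≤ t → ‖y t - xinf‖ ≤ W * D / μ * Real.exp (-μ * (t - t₀)) :=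
    fun t ht => by
      rw [norm_sub_rev]
      have hr := hlim.const_sub (W * D / μ * Real.exp (-μ * (t - t₀)))
      rw [sub_zero] at hr
      refine le_of_tendsto_of_tendsto (hxinf.sub_const (y t)).norm hr ?_
      filter_upwards [Filter.eventually_ge_atTop t] with s hs
      exact hyb t s ht hs
  refine ⟨xinf, fun i t ht => ?_⟩
  have hF := fun s (hs : s ∈ Set.Ioo t₀ t \ S) =>
    hasDerivAt_heatKernel_transport L hwL (x := x) (d := fun j => d j s)
      (fun j => hx j s hs.1.1 hs.2) t i
  have hcont : ContinuousOn (fun s => ∑ j, (heatKernel L (t - s) i j - w j) • x j s)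
      (Set.Icc t₀ t) := by
    refine continuousOn_finsetSum _ fun j _ => ContinuousOn.smul (Continuous.continuousOn ?_)
      ((hc j).mono Set.Icc_subset_Ici_self)
    have : Continuous fun s => heatKernel L s i j := continuous_iff_continuousAt.2 fun s =>
      (hasDerivAt_heatKernel_apply L s i j).continuousAt
    fun_prop
  -- The product of the kernel decay `exp (-ρ (t - s))` and the perturbation decay `exp (-μ (s -
  -- t₀))`. Its integral over `s` brings the factor `1 / (ρ - μ)`, and `μ < ρ` makes the upper
  -- endpoint dominate.
  have hFb : ∀ s ∈ Set.Ioo t₀ t \ S, ‖∑ j, (heatKernel L (t - s) i j - w j) • d j s‖ ≤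
      Fintype.card V * K * D * Real.exp ((ρ - μ) * s + (μ * t₀ - ρ * t)) := fun s hs => by
    have hterm : ∀ j ∈ Finset.univ, ‖(heatKernel L (t - s) i j - w j) • d j s‖ ≤
        K * D * Real.exp ((ρ - μ) * s + (μ * t₀ - ρ * t)) := fun j _ => by
      rw [norm_smul, Real.norm_eq_abs]
      refine (mul_le_mul (hH (t - s) (by linarith [hs.1.2]) i j) (hd j s hs.1.1)
        (norm_nonneg _) (by positivity)).trans_eq ?_
      rw [show (ρ - μ) * s + (μ * t₀ - ρ * t) = -ρ * (t - s) + -μ * (s - t₀) by ring,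
        Real.exp_add]
      ring
    refine (norm_sum_le_of_le _ hterm).trans_eq ?_
    simp; ring
  have h := norm_sub_le_of_hasDerivAt_off_countable ht hS hcont hF
    (fun r => hasDerivAt_const_mul_exp_affine (Fintype.card V * K * D) (ρ - μ)
      (μ * t₀ - ρ * t) r (by linarith)) (by fun_prop) hFb
  have hDnn : 0 ≤ D := by
    have := (norm_nonneg _).trans (hd i (t₀ + 1) (by linarith))
    exact nonneg_of_mul_nonneg_left this (Real.exp_pos _)
  have hFt : ∑ j, (heatKernel L (t - t) i j - w j) • x j t = x i t - y t := by
    simp [heatKernel_zero, Matrix.one_apply, sub_smul, hy]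
  have hF0 : ‖∑ j, (heatKernel L (t - t₀) i j - w j) • x j t₀‖ ≤
      K * (∑ j, ‖x j t₀ - xinf‖) * Real.exp (-μ * (t - t₀)) := by
    -- Recentring at `xinf` costs nothing, since the rows of the kernel and `w` all sum to one.
    have e : ∑ j, (heatKernel L (t - t₀) i j - w j) • x j t₀
        = ∑ j, (heatKernel L (t - t₀) i j - w j) • (x j t₀ - xinf) := by
      simp only [smul_sub, Finset.sum_sub_distrib, ← Finset.sum_smul]
      simp [hrow, hw1]
    rw [e, mul_right_comm, Finset.mul_sum]
    refine (norm_sum_le _ _).trans (Finset.sum_le_sum fun j _ => ?_)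
    rw [norm_smul, Real.norm_eq_abs]
    refine mul_le_mul_of_nonneg_right ((hH _ (sub_nonneg.2 ht) i j).trans ?_) (norm_nonneg _)
    exact mul_le_mul_of_nonneg_left (Real.exp_le_exp.2 (by nlinarith)) hK
  rw [hFt] at h
  have hB : Fintype.card V * K * D / (ρ - μ) * Real.exp ((ρ - μ) * t + (μ * t₀ - ρ * t))
      - Fintype.card V * K * D / (ρ - μ) * Real.exp ((ρ - μ) * t₀ + (μ * t₀ - ρ * t)) ≤
      Fintype.card V * K * D / (ρ - μ) * Real.exp (-μ * (t - t₀)) := by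
    rw [show (ρ - μ) * t + (μ * t₀ - ρ * t) = -μ * (t - t₀) by ring]
    have : 0 ≤ Fintype.card V * K * D / (ρ - μ) :=
      div_nonneg (by positivity) (by linarith)
    have := mul_nonneg this (Real.exp_pos ((ρ - μ) * t₀ + (μ * t₀ - ρ * t))).le
    linarith
  have e1 : x i t - xinf = (x i t - y t - ∑ j, (heatKernel L (t - t₀) i j - w j) • x j t₀)
      + (∑ j, (heatKernel L (t - t₀) i j - w j) • x j t₀) + (y t - xinf) := by abel
  rw [e1]
  refine (norm_add₃_le).trans ((add_le_add (add_le_add (h.trans hB) hF0) (hyinf t ht)).trans_eq ?_)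
  ring

end Consensus

/-! ### Rotations and the Gram–Schmidt frame: equivariance, bounds, differentiability. -/

section Frames

theorem act_eq_toEuclideanCLM (M : Matrix (Fin 3) (Fin 3) ℝ) (x : E3) :
    act M x = Matrix.toEuclideanCLM (𝕜 := ℝ) M x := rfl

theorem act_act (M N : Matrix (Fin 3) (Fin 3) ℝ) (x : E3) : act M (act N x) = act (M * N) x := by
  simp [act, Matrix.mulVec_mulVec]

theorem act_one (x : E3) : act 1 x = x := by simp [act]

theorem act_sub (M : Matrix (Fin 3) (Fin 3) ℝ) (x y : E3) : act M (x - y) = act M x - act M y := by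
  simp only [act_eq_toEuclideanCLM, map_sub]

theorem act_smul (M : Matrix (Fin 3) (Fin 3) ℝ) (c : ℝ) (x : E3) :
    act M (c • x) = c • act M x := by
  simp only [act_eq_toEuclideanCLM, map_smul]

theorem act_sum {ι : Type*} (M : Matrix (Fin 3) (Fin 3) ℝ) (s : Finset ι) (x : ι → E3) :
    act M (∑ i ∈ s, x i) = ∑ i ∈ s, act M (x i) := by
  simp only [act_eq_toEuclideanCLM, map_sum]

theorem inner_eq_dotProduct (x y : E3) : inner ℝ x y = x.ofLp ⬝ᵥ y.ofLp := by
  rw [EuclideanSpace.inner_eq_star_dotProduct, dotProduct_comm]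
  simp

theorem norm_sq_eq_dotProduct (x : E3) : ‖x‖ ^ 2 = x.ofLp ⬝ᵥ x.ofLp := by
  rw [← real_inner_self_eq_norm_sq, inner_eq_dotProduct]

section Rotation

variable {R : Matrix (Fin 3) (Fin 3) ℝ} (hR : R ∈ Matrix.specialOrthogonalGroup (Fin 3) ℝ)
include hR

theorem rotation_transpose_mul : Rᵀ * R = 1 :=
  (Matrix.mem_orthogonalGroup_iff' (Fin 3) ℝ).1 (Matrix.mem_specialOrthogonalGroup_iff.1 hR).1

theorem rotation_inv_eq_transpose : R⁻¹ = Rᵀ :=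
  Matrix.inv_eq_left_inv (rotation_transpose_mul hR)

theorem rotation_inv_mul : R⁻¹ * R = 1 := by
  rw [rotation_inv_eq_transpose hR, rotation_transpose_mul hR]

theorem rotation_mul_inv : R * R⁻¹ = 1 := mul_eq_one_comm.1 (rotation_inv_mul hR)

theorem inner_act_act (x y : E3) : inner ℝ (act R x) (act R y) = inner ℝ x y := by
  simp only [inner_eq_dotProduct, act]
  rw [Matrix.dotProduct_mulVec, Matrix.vecMul_mulVec, rotation_transpose_mul hR, Matrix.vecMul_one]

theorem norm_act (x : E3) : ‖act R x‖ = ‖x‖ := by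
  rw [← sq_eq_sq₀ (norm_nonneg _) (norm_nonneg _), ← real_inner_self_eq_norm_sq,
    ← real_inner_self_eq_norm_sq, inner_act_act hR]

/-- Cross products transform by the cofactor matrix, and a rotation is its own cofactor matrix: its
inverse is its transpose and its determinant is one. -/
theorem crossProduct_mulVec (u v : Fin 3 → ℝ) :
    crossProduct (R *ᵥ u) (R *ᵥ v) = R *ᵥ crossProduct u v := by
  have h : R = R.adjugateᵀ := by
    have hdet : R.det = 1 := (Matrix.mem_specialOrthogonalGroup_iff.1 hR).2
    have := rotation_inv_eq_transpose hR
    rw [Matrix.inv_def, hdet] at this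
    simp only [Ring.inverse_one, one_smul] at this
    rw [this, Matrix.transpose_transpose]
  conv_rhs => rw [h, Matrix.adjugate_fin_three]
  ext i
  fin_cases i <;>
    simp [crossProduct, Matrix.mulVec, dotProduct, Fin.sum_univ_three] <;> ring

theorem frameFst_act (a : E3) : frameFst (act R a) = act R (frameFst a) := by
  rw [frameFst, frameFst, norm_act hR, act_smul]

theorem gramSchmidtSnd_act (a b : E3) :
    gramSchmidtSnd (act R a) (act R b) = act R (gramSchmidtSnd a b) := by
  rw [gramSchmidtSnd, gramSchmidtSnd, frameFst_act hR, inner_act_act hR, act_sub, act_smul]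

theorem frameSnd_act (a b : E3) : frameSnd (act R a) (act R b) = act R (frameSnd a b) := by
  rw [frameSnd, frameSnd, gramSchmidtSnd_act hR, norm_act hR, act_smul]

theorem frameTrd_act (a b : E3) : frameTrd (act R a) (act R b) = act R (frameTrd a b) := by
  rw [frameTrd, frameTrd, frameFst_act hR, frameSnd_act hR]
  simp only [act, crossProduct_mulVec hR]

end Rotation

theorem act_orientationEstimate (a b v : E3) : act (orientationEstimate a b) v =
    v 0 • frameFst a + v 1 • frameSnd a b + v 2 • frameTrd a b := by
  ext r
  simp [act, orientationEstimate, Matrix.mulVec, dotProduct, Fin.sum_univ_three, mul_comm]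

theorem matrix_eq_of_act {M N : Matrix (Fin 3) (Fin 3) ℝ} (h : ∀ v, act M v = act N v) : M = N :=
  (Matrix.toEuclideanCLM (n := Fin 3) (𝕜 := ℝ)).injective (ContinuousLinearMap.ext h)

/-- The Gram–Schmidt frame is equivariant under rotations. -/
theorem orientationEstimate_act {R : Matrix (Fin 3) (Fin 3) ℝ}
    (hR : R ∈ Matrix.specialOrthogonalGroup (Fin 3) ℝ) (a b : E3) :
    orientationEstimate (act R a) (act R b) = R * orientationEstimate a b := by
  refine matrix_eq_of_act fun v => ?_
  rw [← act_act, act_orientationEstimate, act_orientationEstimate, frameFst_act hR,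
    frameSnd_act hR, frameTrd_act hR]
  simp only [act_eq_toEuclideanCLM, map_add, map_smul]

theorem norm_inv_norm_smul_le (x : E3) : ‖‖x‖⁻¹ • x‖ ≤ 1 := by
  rw [norm_smul, norm_inv, norm_norm]
  exact inv_mul_le_one

theorem norm_frameTrd_sq (a b : E3) : ‖frameTrd a b‖ ^ 2 =
    ‖frameFst a‖ ^ 2 * ‖frameSnd a b‖ ^ 2 - inner ℝ (frameFst a) (frameSnd a b) ^ 2 := by
  simp only [norm_sq_eq_dotProduct, inner_eq_dotProduct, frameTrd]
  rw [cross_dot_cross, dotProduct_comm (frameSnd a b).ofLp (frameFst a).ofLp]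
  ring

/-- No independence is needed: normalizing the zero vector yields zero because `0⁻¹ = 0`, so every
column has norm at most one. This controls the estimate even at instants where it is meaningless. -/
theorem norm_act_orientationEstimate_le (a b v : E3) :
    ‖act (orientationEstimate a b) v‖ ≤ 3 * ‖v‖ := by
  have h1 : ‖frameFst a‖ ≤ 1 := norm_inv_norm_smul_le a
  have h2 : ‖frameSnd a b‖ ≤ 1 := norm_inv_norm_smul_le _
  have h3 : ‖frameTrd a b‖ ≤ 1 := by
    refine abs_le_of_sq_le_sq' ?_ zero_le_one |>.2
    rw [norm_frameTrd_sq]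
    have := mul_le_mul (pow_le_one₀ (n := 2) (norm_nonneg _) h1)
      (pow_le_one₀ (n := 2) (norm_nonneg _) h2) (by positivity) zero_le_one
    nlinarith [sq_nonneg (inner ℝ (frameFst a) (frameSnd a b))]
  have key : ∀ (i : Fin 3) (x : E3), ‖x‖ ≤ 1 → ‖v i • x‖ ≤ ‖v‖ := fun i x hx => by
    rw [norm_smul]
    exact mul_le_of_le_one_right (norm_nonneg _) hx |>.trans (PiLp.norm_apply_le v i)
  rw [act_orientationEstimate]
  refine norm_add₃_le.trans ?_
  linarith [key 0 _ h1, key 1 _ h2, key 2 _ h3]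

theorem differentiableAt_cross {F : Type*} [NormedAddCommGroup F] [NormedSpace ℝ F]
    {f g : F → E3} {x : F} (hf : DifferentiableAt ℝ f x) (hg : DifferentiableAt ℝ g x) :
    DifferentiableAt ℝ
      (fun y => (WithLp.toLp 2 (crossProduct (f y).ofLp (g y).ofLp) : E3)) x := by
  rw [differentiableAt_euclidean] at hf hg ⊢
  have key : ∀ i j k l : Fin 3, DifferentiableAt ℝ (fun y => f y i * g y j - f y k * g y l) x :=
    fun i j k l => ((hf i).mul (hg j)).sub ((hf k).mul (hg l))
  intro i
  match i with
  | 0 => exact key 1 2 2 1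
  | 1 => exact key 2 0 0 2
  | 2 => exact key 0 1 1 0

theorem differentiableAt_inv_norm_smul {F : Type*} [NormedAddCommGroup F] [NormedSpace ℝ F]
    {f : F → E3} {x : F} (hf : DifferentiableAt ℝ f x) (h0 : f x ≠ 0) :
    DifferentiableAt ℝ (fun y => ‖f y‖⁻¹ • f y) x :=
  ((hf.norm ℝ h0).inv (norm_ne_zero_iff.2 h0)).smul hf

section Independent

variable {a b : E3} (h : LinearIndependent ℝ ![a, b])
include h

theorem gramSchmidtSnd_ne_zero : gramSchmidtSnd a b ≠ 0 := by
  intro h0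
  rw [gramSchmidtSnd, frameFst, smul_smul, sub_eq_zero] at h0
  have := LinearIndependent.pair_iff.1 h (inner ℝ b (‖a‖⁻¹ • a) * ‖a‖⁻¹) (-1)
    (by rw [← h0]; simp)
  simp at this

theorem norm_frameFst : ‖frameFst a‖ = 1 := by
  rw [frameFst, norm_smul, norm_inv, norm_norm]
  exact inv_mul_cancel₀ (norm_ne_zero_iff.2 (by simpa using h.ne_zero 0))

theorem norm_frameSnd : ‖frameSnd a b‖ = 1 := by
  rw [frameSnd, norm_smul, norm_inv, norm_norm]
  exact inv_mul_cancel₀ (norm_ne_zero_iff.2 (gramSchmidtSnd_ne_zero h))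

theorem inner_frameFst_frameSnd : inner ℝ (frameFst a) (frameSnd a b) = 0 := by
  rw [frameSnd, inner_smul_right, gramSchmidtSnd, inner_sub_right, inner_smul_right,
    real_inner_self_eq_norm_sq, norm_frameFst h, real_inner_comm]
  simp

theorem orientationEstimate_mem :
    orientationEstimate a b ∈ Matrix.specialOrthogonalGroup (Fin 3) ℝ := by
  have h11 := norm_sq_eq_dotProduct (frameFst a)
  have h22 := norm_sq_eq_dotProduct (frameSnd a b)
  have h33 := norm_sq_eq_dotProduct (frameTrd a b)
  have h12 := inner_eq_dotProduct (frameFst a) (frameSnd a b)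
  rw [norm_frameTrd_sq, norm_frameFst h, norm_frameSnd h, inner_frameFst_frameSnd h] at h33
  rw [norm_frameFst h] at h11
  rw [norm_frameSnd h] at h22
  rw [inner_frameFst_frameSnd h] at h12
  have h13 := dot_self_cross (frameFst a).ofLp (frameSnd a b).ofLp
  have h23 := dot_cross_self (frameFst a).ofLp (frameSnd a b).ofLp
  -- A determinant whose third column is `b₁ × b₂` equals `‖b₁ × b₂‖²`, which is `1` by `h33`.
  have hdet : (orientationEstimate a b).det = 1 := by
    have e := h33
    have e2 := norm_sq_eq_dotProduct (frameTrd a b)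
    simp only [frameTrd, crossProduct, LinearMap.mk₂_apply, dotProduct, Fin.sum_univ_three,
      Matrix.cons_val] at e
    rw [Matrix.det_fin_three]
    simp only [orientationEstimate, frameTrd, crossProduct, LinearMap.mk₂_apply, Matrix.of_apply,
      Matrix.cons_val]
    linarith
  rw [Matrix.mem_specialOrthogonalGroup_iff]
  refine ⟨(Matrix.mem_orthogonalGroup_iff' (Fin 3) ℝ).2 ?_, hdet⟩
  have hcol : ∀ r s : Fin 3, ((orientationEstimate a b)ᵀ * orientationEstimate a b) r s =
      (![frameFst a, frameSnd a b, frameTrd a b] r).ofLp ⬝ᵥ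
        (![frameFst a, frameSnd a b, frameTrd a b] s).ofLp := fun r s => rfl
  ext r s
  rw [hcol]
  have h13' : (frameFst a).ofLp ⬝ᵥ (frameTrd a b).ofLp = 0 := h13
  have h23' : (frameSnd a b).ofLp ⬝ᵥ (frameTrd a b).ofLp = 0 := h23
  fin_cases r <;> fin_cases s <;> simp [h13', h23', ← h11, ← h22, ← h33, ← h12,
    dotProduct_comm (frameSnd a b).ofLp (frameFst a).ofLp,
    dotProduct_comm (frameTrd a b).ofLp (frameFst a).ofLp,
    dotProduct_comm (frameTrd a b).ofLp (frameSnd a b).ofLp]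

theorem differentiableAt_act_orientationEstimate (v : E3) :
    DifferentiableAt ℝ (fun x : E3 × E3 => act (orientationEstimate x.1 x.2) v) (a, b) := by
  have h1 : DifferentiableAt ℝ (fun x : E3 × E3 => frameFst x.1) (a, b) :=
    differentiableAt_inv_norm_smul differentiableAt_fst (by simpa using h.ne_zero 0)
  have h2' : DifferentiableAt ℝ (fun x : E3 × E3 => gramSchmidtSnd x.1 x.2) (a, b) :=
    differentiableAt_snd.sub ((differentiableAt_snd.inner ℝ h1).smul h1)
  have h2 : DifferentiableAt ℝ (fun x : E3 × E3 => frameSnd x.1 x.2) (a, b) :=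
    differentiableAt_inv_norm_smul h2' (gramSchmidtSnd_ne_zero h)
  have h3 : DifferentiableAt ℝ (fun x : E3 × E3 => frameTrd x.1 x.2) (a, b) :=
    differentiableAt_cross h1 h2
  have e : (fun x : E3 × E3 => act (orientationEstimate x.1 x.2) v) = fun x =>
      v 0 • frameFst x.1 + v 1 • frameSnd x.1 x.2 + v 2 • frameTrd x.1 x.2 :=
    funext fun x => act_orientationEstimate x.1 x.2 v
  rw [e]
  exact ((h1.fun_const_smul (v 0)).fun_add (h2.fun_const_smul (v 1))).fun_add
    (h3.fun_const_smul (v 2))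

end Independent

theorem act_single_apply (M : Matrix (Fin 3) (Fin 3) ℝ) (r c : Fin 3) :
    act M (EuclideanSpace.single c 1) r = M r c := by
  simp [act]

theorem tendsto_matrix_of_act {α : Type*} {f : Filter α} {M : α → Matrix (Fin 3) (Fin 3) ℝ}
    {N : Matrix (Fin 3) (Fin 3) ℝ}
    (h : ∀ v, Filter.Tendsto (fun x => act (M x) v) f (nhds (act N v))) :
    Filter.Tendsto M f (nhds N) := by
  refine tendsto_pi_nhds.2 fun r => tendsto_pi_nhds.2 fun c => ?_
  have hr : Continuous fun x : E3 => x r := by fun_prop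
  simpa [Function.comp_def, act_single_apply] using
    (hr.tendsto _).comp (h (EuclideanSpace.single c 1))

end Frames

/-! ### The graph Laplacian and the column space of `L ⊗ I`. -/

section Laplacian

variable {V : Type*} [Fintype V] {G : Digraph V} {a : V → V → ℝ}

theorem mem_neighbors {i j : V} : j ∈ neighbors G i ↔ G.Adj j i := by
  simp [neighbors]

open Classical in
theorem laplacian_apply (hloop : ∀ i, ¬ G.Adj i i) (i j : V) :
    laplacian G a i j = (if i = j then ∑ k ∈ neighbors G i, a i k else 0)
      - (if j ∈ neighbors G i then a i j else 0) := by
  by_cases h : i = j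
  · subst h
    simp [laplacian, mem_neighbors, hloop]
  · by_cases h2 : j ∈ neighbors G i <;> simp [laplacian, h, h2]

theorem sum_laplacian_smul {E : Type*} [AddCommGroup E] [Module ℝ E]
    (hloop : ∀ i, ¬ G.Adj i i) (i : V) (x : V → E) :
    ∑ j, laplacian G a i j • x j = ∑ j ∈ neighbors G i, a i j • (x i - x j) := by
  classical
  simp only [laplacian_apply hloop, sub_smul, ite_smul, zero_smul, Finset.sum_sub_distrib, smul_sub]
  simp [Finset.sum_smul]

theorem isRootedLaplacian_laplacian (hloop : ∀ i, ¬ G.Adj i i) (hroot : HasRootedOutBranch G)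
    (ha : ∀ i, ∀ j ∈ neighbors G i, 0 < a i j) : IsRootedLaplacian (laplacian G a) where
  off_diag i j hij := by
    rw [laplacian_apply hloop, if_neg hij]
    split_ifs with h
    · linarith [ha i j h]
    · simp
  row_sum i := by
    simpa using sum_laplacian_smul (a := a) hloop i (fun _ => (1 : ℝ))
  root := by
    obtain ⟨r, hr⟩ := hroot
    refine ⟨r, fun i => Relation.ReflTransGen.mono (fun j k hjk => ?_) _ _ (hr i)⟩
    have hne : k ≠ j := fun h => hloop j (h ▸ hjk)
    rw [laplacian_apply hloop, if_neg hne, if_pos (mem_neighbors.2 hjk)]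
    linarith [ha k j (mem_neighbors.2 hjk)]

/-- If the left kernel of `L` is spanned by `w`, a stacked vector outside the column space of
`L ⊗ I` has a nonzero weighted average. -/
theorem weighted_sum_ne_zero_of_notMem_columnSpace {L : Matrix V V ℝ} {w : V → ℝ}
    (hw : ∀ v : V → ℝ, v ᵥ* L = 0 → ∀ j, v j = (∑ i, v i) * w j)
    {q : V → E3}
    (hq : (fun x : V × Fin 3 => q x.1 x.2) ∉
      columnSpace (L ⊗ₖ (1 : Matrix (Fin 3) (Fin 3) ℝ))) :
    ∑ i, w i • q i ≠ 0 := by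
  classical
  intro h0
  -- Duality: `f` kills the column space but not `q`. For each coordinate `c` its coefficients form
  -- a left-kernel vector of `L`, hence a multiple of `w`, so `f q` is a combination of the
  -- vanishing averages.
  obtain ⟨f, hfq, hf⟩ := Submodule.exists_le_ker_of_notMem hq
  have hrep : ∀ y : V × Fin 3 → ℝ, f y = ∑ c, ∑ i, f (Pi.single (i, c) 1) * y (i, c) := by
    intro y
    rw [LinearMap.pi_apply_eq_sum_univ f y, Fintype.sum_prod_type, Finset.sum_comm]
    refine Finset.sum_congr rfl fun c _ => Finset.sum_congr rfl fun i _ => ?_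
    rw [smul_eq_mul, mul_comm]
    congr 2
    funext x
    simp [Pi.single_apply, eq_comm]
  have hker : ∀ c, (fun i => f (Pi.single (i, c) 1)) ᵥ* L = 0 := by
    intro c
    funext j
    have h1 : f (fun x => (L ⊗ₖ (1 : Matrix (Fin 3) (Fin 3) ℝ)) x (j, c)) = 0 :=
      hf (Submodule.subset_span ⟨(j, c), rfl⟩)
    rw [hrep, Finset.sum_eq_single c] at h1
    · simpa [Matrix.vecMul, dotProduct] using h1
    · intro b _ hb
      simp [hb]
    · simp
  apply hfq
  rw [hrep]
  refine Finset.sum_eq_zero fun c _ => ?_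
  have h2 : ∑ i, w i * q i c = 0 := by
    have := congrArg (fun x : E3 => x c) h0
    simpa using this
  calc ∑ i, f (Pi.single (i, c) 1) * q i c
      = ∑ i, (∑ k, f (Pi.single (k, c) 1)) * (w i * q i c) :=
        Finset.sum_congr rfl fun i _ => by rw [hw _ (hker c) i]; ring
    _ = 0 := by rw [← Finset.mul_sum, h2, mul_zero]

end Laplacian

/-! ### Linear dependence of analytic curves occurs at countably many instants. -/

section Analytic

/-- An analytic function on the line with a nonzero limit at infinity has countably many zeros. -/
theorem countable_zeros_of_analytic {g : ℝ → ℝ} (hg : ∀ t, AnalyticAt ℝ g t) {c : ℝ} (hc : c ≠ 0)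
    (hlim : Filter.Tendsto g Filter.atTop (nhds c)) : {t | g t = 0}.Countable := by
  -- One nonzero value excludes the zero function, so the zeros form a closed discrete set,
  -- countable because the line is Lindelöf.
  obtain ⟨x, hx⟩ := (hlim.eventually_ne hc).exists
  have h : (g ⁻¹' {0})ᶜ ∈ Filter.codiscrete ℝ :=
    AnalyticOnNhd.preimage_zero_mem_codiscrete (fun t _ => hg t) hx
  have hd : IsDiscrete {t | g t = 0} := (compl_mem_codiscrete_iff.1 h).2
  have : DiscreteTopology {t | g t = 0} := hd.to_subtype
  exact Set.countable_coe_iff.1 countable_of_Lindelof_of_discrete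

/-- Encodes dependence as the vanishing of a single polynomial in the coordinates, to which the
analytic zero count applies. -/
theorem linearIndependent_iff_cross (a b : E3) : LinearIndependent ℝ ![a, b] ↔
    crossProduct a.ofLp b.ofLp ⬝ᵥ crossProduct a.ofLp b.ofLp ≠ 0 := by
  rw [Ne, dotProduct_self_eq_zero, ← Ne, crossProduct_ne_zero_iff_linearIndependent,
    LinearIndependent.pair_iff, LinearIndependent.pair_iff]
  refine forall₂_congr fun s t => imp_congr_left ?_
  rw [← WithLp.ofLp_eq_zero 2]
  rfl

theorem linearIndependent_act {R : Matrix (Fin 3) (Fin 3) ℝ}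
    (hR : R ∈ Matrix.specialOrthogonalGroup (Fin 3) ℝ) {a b : E3}
    (h : LinearIndependent ℝ ![a, b]) : LinearIndependent ℝ ![act R a, act R b] := by
  rw [LinearIndependent.pair_iff] at h ⊢
  intro s t hst
  refine h s t ?_
  have e : act R (s • a + t • b) = s • act R a + t • act R b := by
    simp only [act_eq_toEuclideanCLM, map_add, map_smul]
  rw [← norm_eq_zero, ← norm_act hR, e, hst, norm_zero]

/-- Two analytic curves converging to linearly independent limits are linearly dependent only at
countably many instants. -/
theorem countable_not_linearIndependent {x y : ℝ → E3} {x' y' : E3}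
    (hx : ∀ c t, AnalyticAt ℝ (fun s => x s c) t) (hy : ∀ c t, AnalyticAt ℝ (fun s => y s c) t)
    (hx' : Filter.Tendsto x Filter.atTop (nhds x')) (hy' : Filter.Tendsto y Filter.atTop (nhds y'))
    (h : LinearIndependent ℝ ![x', y']) :
    {t | ¬ LinearIndependent ℝ ![x t, y t]}.Countable := by
  have hcont : Continuous fun p : E3 × E3 =>
      crossProduct p.1.ofLp p.2.ofLp ⬝ᵥ crossProduct p.1.ofLp p.2.ofLp := by
    simp only [crossProduct, LinearMap.mk₂_apply, dotProduct, Fin.sum_univ_three, Matrix.cons_val]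
    fun_prop
  have hlim := (hcont.tendsto (x', y')).comp (hx'.prodMk_nhds hy')
  have han : ∀ t, AnalyticAt ℝ (fun s => crossProduct (x s).ofLp (y s).ofLp ⬝ᵥ
      crossProduct (x s).ofLp (y s).ofLp) t := fun t => by
    have key : ∀ i j k l : Fin 3,
        AnalyticAt ℝ (fun s => (x s i * y s j - x s k * y s l)
          * (x s i * y s j - x s k * y s l)) t := fun i j k l =>
      ((((hx i t).fun_mul (hy j t)).fun_sub ((hx k t).fun_mul (hy l t))).fun_mul
        (((hx i t).fun_mul (hy j t)).fun_sub ((hx k t).fun_mul (hy l t))))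
    simp only [crossProduct, LinearMap.mk₂_apply, dotProduct, Fin.sum_univ_three, Matrix.cons_val]
    exact ((key 1 2 2 1).fun_add (key 2 0 0 2)).fun_add (key 0 1 1 0)
  refine (countable_zeros_of_analytic han ((linearIndependent_iff_cross _ _).1 h) hlim).mono ?_
  intro t ht
  simpa [linearIndependent_iff_cross] using ht

end Analytic

/-! ### Exponential convergence of the orientation estimates. -/

section Decay

theorem tendsto_of_exp_decay {E : Type*} [NormedAddCommGroup E] {x : ℝ → E} {x' : E}
    {ρ t₀ M : ℝ} (hρ : 0 < ρ)
    (h : ∀ t, t₀ ≤ t → ‖x t - x'‖ ≤ M * Real.exp (-ρ * (t - t₀))) :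
    Filter.Tendsto x Filter.atTop (nhds x') := by
  rw [tendsto_iff_norm_sub_tendsto_zero]
  refine squeeze_zero' (.of_forall fun t => norm_nonneg _)
    (Filter.eventually_ge_atTop t₀ |>.mono fun t ht => h t ht) ?_
  simpa using (tendsto_exp_decay hρ t₀).const_mul M

/-- The Gram–Schmidt frame inherits exponential convergence. -/
theorem exists_orientationEstimate_decay {x y : ℝ → E3} {x' y' : E3} {ρ t₀ M : ℝ} (hρ : 0 < ρ)
    (hx : ∀ t, t₀ ≤ t → ‖x t - x'‖ ≤ M * Real.exp (-ρ * (t - t₀)))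
    (hy : ∀ t, t₀ ≤ t → ‖y t - y'‖ ≤ M * Real.exp (-ρ * (t - t₀)))
    (h : LinearIndependent ℝ ![x', y']) (v : E3) :
    ∃ D : ℝ, 0 ≤ D ∧ ∀ t, t₀ ≤ t →
      ‖act (orientationEstimate (x t) (y t)) v - act (orientationEstimate x' y') v‖ ≤
        D * Real.exp (-ρ * (t - t₀)) := by
  have hO := (differentiableAt_act_orientationEstimate h v).isBigO_sub
  have hlim : Filter.Tendsto (fun t => (x t, y t)) Filter.atTop (nhds (x', y')) :=
    (tendsto_of_exp_decay hρ hx).prodMk_nhds (tendsto_of_exp_decay hρ hy)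
  obtain ⟨A, hA, hbound⟩ := (hO.comp_tendsto hlim).exists_pos
  obtain ⟨T, hT⟩ := Filter.eventually_atTop.1 hbound.bound
  have hB : 0 ≤ 6 * ‖v‖ * Real.exp (ρ * (T - t₀)) := by positivity
  -- After `T` differentiability at the limit gives the first summand. Before `T` the crude bound
  -- `3‖v‖ + 3‖v‖` is used, and `exp (ρ (T - t₀))` offsets the decay up to then.
  refine ⟨A * |M| + 6 * ‖v‖ * Real.exp (ρ * (T - t₀)), by positivity, fun t ht => ?_⟩
  have hE := Real.exp_pos (-ρ * (t - t₀))
  rcases le_total T t with hTt | hTt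
  · have h1 := hT t hTt
    have h2 : ‖(x t, y t) - (x', y')‖ ≤ |M| * Real.exp (-ρ * (t - t₀)) :=
      max_le ((hx t ht).trans (mul_le_mul_of_nonneg_right (le_abs_self M) hE.le))
        ((hy t ht).trans (mul_le_mul_of_nonneg_right (le_abs_self M) hE.le))
    refine h1.trans ((mul_le_mul_of_nonneg_left h2 hA.le).trans ?_)
    rw [← mul_assoc]
    exact mul_le_mul_of_nonneg_right (le_add_of_nonneg_right hB) hE.le
  · have h1 := norm_sub_le (act (orientationEstimate (x t) (y t)) v)
      (act (orientationEstimate x' y') v)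
    have h2 := norm_act_orientationEstimate_le (x t) (y t) v
    have h3 := norm_act_orientationEstimate_le x' y' v
    have h4 : 1 ≤ Real.exp (ρ * (T - t₀)) * Real.exp (-ρ * (t - t₀)) := by
      rw [← Real.exp_add]
      exact Real.one_le_exp (by nlinarith)
    calc _ ≤ 6 * ‖v‖ * 1 := by linarith
      _ ≤ 6 * ‖v‖ * (Real.exp (ρ * (T - t₀)) * Real.exp (-ρ * (t - t₀))) :=
        mul_le_mul_of_nonneg_left h4 (by positivity)
      _ ≤ _ := by
        rw [← mul_assoc]
        exact mul_le_mul_of_nonneg_right (le_add_of_nonneg_left (by positivity)) hE.le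

end Decay

/-! ### Both laws rewritten as consensus dynamics. -/

section Dynamics

variable {V : Type*} [Fintype V] {G : Digraph V} {C : V → Matrix (Fin 3) (Fin 3) ℝ}

omit [Fintype V] in
theorem act_act_inv (hC : ∀ i, C i ∈ Matrix.specialOrthogonalGroup (Fin 3) ℝ) (i : V) (x : E3) :
    act (C i) (act (C i)⁻¹ x) = x := by
  rw [act_act, rotation_mul_inv (hC i), act_one]

omit [Fintype V] in
theorem act_inv_act (hC : ∀ i, C i ∈ Matrix.specialOrthogonalGroup (Fin 3) ℝ) (i : V) (x : E3) :
    act (C i)⁻¹ (act (C i) x) = x := by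
  rw [act_act, rotation_inv_mul (hC i), act_one]

theorem hasDerivWithinAt_act (M : Matrix (Fin 3) (Fin 3) ℝ) {x : ℝ → E3} {x' : E3} {s : Set ℝ}
    {t : ℝ} (h : HasDerivWithinAt x x' s t) :
    HasDerivWithinAt (fun t => act M (x t)) (act M x') s t :=
  (Matrix.toEuclideanCLM (n := Fin 3) (𝕜 := ℝ) M).hasFDerivAt.comp_hasDerivWithinAt t h

/-- In the aligned coordinates `C_i⁻¹ z_i` the estimation law is the consensus dynamics. -/
theorem act_inv_estimationLaw (hloop : ∀ i, ¬ G.Adj i i) (a : V → V → ℝ)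
    (hC : ∀ i, C i ∈ Matrix.specialOrthogonalGroup (Fin 3) ℝ) (z : V → E3) (i : V) :
    act (C i)⁻¹ (estimationLaw G a C z i)
      = -∑ j, laplacian G a i j • act (C j)⁻¹ (z j) := by
  rw [sum_laplacian_smul hloop, estimationLaw, act_sum, ← Finset.sum_neg_distrib]
  refine Finset.sum_congr rfl fun j _ => ?_
  have hinv : (C i)⁻¹ * (relOrientation C j i)⁻¹ = (C j)⁻¹ := by
    have hu : IsUnit (C i).det := by
      rw [(Matrix.mem_specialOrthogonalGroup_iff.1 (hC i)).2]; exact isUnit_one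
    rw [relOrientation, Matrix.mul_inv_rev, Matrix.nonsing_inv_nonsing_inv _ hu, ← mul_assoc,
      rotation_inv_mul (hC i), one_mul]
  rw [act_smul, act_sub, act_act, hinv, ← smul_neg, neg_sub]

theorem hasDerivAt_aligned (hloop : ∀ i, ¬ G.Adj i i) {a : V → V → ℝ}
    (hC : ∀ i, C i ∈ Matrix.specialOrthogonalGroup (Fin 3) ℝ) {t₀ : ℝ} {z : Fin 2 → V → ℝ → E3}
    (hz : IsEstimationTrajectory G a C t₀ z) (k : Fin 2) (i : V) {t : ℝ} (ht : t₀ ≤ t) :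
    HasDerivWithinAt (fun t => act (C i)⁻¹ (z k i t))
      (-∑ j, laplacian G a i j • act (C j)⁻¹ (z k j t)) (Set.Ici t₀) t := by
  rw [← act_inv_estimationLaw hloop a hC]
  exact hasDerivWithinAt_act _ (hz k i t ht)

/-- The control law in the error coordinates `p_i - C* p_i*`. -/
theorem act_inv_localControl (hloop : ∀ i, ¬ G.Adj i i) (l : V → V → ℝ) (ku : ℝ)
    (hC : ∀ i, C i ∈ Matrix.specialOrthogonalGroup (Fin 3) ℝ) (pstar p : V → E3)
    (Cstar F : Matrix (Fin 3) (Fin 3) ℝ) (i : V) :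
    act (C i)⁻¹ (localControl G l ku C pstar (C i * F) p i)
      = -(∑ j, laplacian G (fun i j => ku * l i j) i j • (p j - act Cstar (pstar j)))
        + -∑ j ∈ neighbors G i, (ku * l i j) •
          (act F (pstar j - pstar i) - act Cstar (pstar j - pstar i)) := by
  rw [sum_laplacian_smul hloop, localControl, act_smul, act_sum, Finset.smul_sum, ← neg_add,
    ← Finset.sum_add_distrib, ← Finset.sum_neg_distrib]
  refine Finset.sum_congr rfl fun j _ => ?_
  rw [act_smul, smul_smul, ← smul_add, ← smul_neg, act_sub, act_inv_act hC, ← act_act,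
    act_inv_act hC, act_sub Cstar]
  congr 1
  abel

end Dynamics

end FormationControl

/-! ### The main theorem. -/

theorem mainTheorem1 {V : Type*} [Fintype V]
    (G : Digraph V) (hloop : ∀ i, ¬ G.Adj i i)
    (hroot : FormationControl.HasRootedOutBranch G)
    (a l : V → V → ℝ)
    (ha : ∀ i, ∀ j ∈ FormationControl.neighbors G i, 0 < a i j)
    (hl : ∀ i, ∀ j ∈ FormationControl.neighbors G i, 0 < l i j)
    (ku : ℝ) (hku : 0 < ku) :
    ∃ rate K₁ : ℝ, 0 < rate ∧ 0 < K₁ ∧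
      ∀ (C : V → Matrix (Fin 3) (Fin 3) ℝ)
        (_ : ∀ i, C i ∈ Matrix.specialOrthogonalGroup (Fin 3) ℝ)
        (pstar : V → FormationControl.E3) (t₀ : ℝ)
        (z : Fin 2 → V → ℝ → FormationControl.E3)
        (_ : FormationControl.IsEstimationTrajectory G a C t₀ z)
        (_ : ∀ k : Fin 2, FormationControl.alignedState C (fun i => z k i t₀) ∉
          FormationControl.columnSpace
            (FormationControl.laplacian G a ⊗ₖ (1 : Matrix (Fin 3) (Fin 3) ℝ)))
        (_ : ∀ c : ℝ, FormationControl.alignedState C (fun i => z 1 i t₀)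
            - c • FormationControl.alignedState C (fun i => z 0 i t₀) ∉
          FormationControl.columnSpace
            (FormationControl.laplacian G a ⊗ₖ (1 : Matrix (Fin 3) (Fin 3) ℝ))),
        ∃ Cstar ∈ Matrix.specialOrthogonalGroup (Fin 3) ℝ,
          (∀ i, Filter.Tendsto
            (fun t => (C i)⁻¹ * FormationControl.orientationEstimate (z 0 i t) (z 1 i t))
            Filter.atTop (nhds Cstar)) ∧
          ∃ K₂ : ℝ, 0 ≤ K₂ ∧
            ∀ p : V → ℝ → FormationControl.E3,
              FormationControl.IsFormationTrajectory G l ku C pstar t₀ z p →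
              ∃ pinf : FormationControl.E3, ∀ i t, t₀ ≤ t →
                ‖p i t - (FormationControl.act Cstar (pstar i) + pinf)‖ ≤
                  (K₁ * ∑ j, ‖p j t₀ - (FormationControl.act Cstar (pstar j) + pinf)‖ + K₂)
                    * Real.exp (-rate * (t - t₀)) := by
  classical
  obtain ⟨w, hw1, hwL, hwuniq, K, ρ, hK, hρ, hH⟩ :=
    (FormationControl.isRootedLaplacian_laplacian hloop hroot ha).exists_weight
  have hLl := FormationControl.isRootedLaplacian_laplacian (a := fun i j => ku * l i j) hloop hroot
    fun i j hj => mul_pos hku (hl i j hj)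
  obtain ⟨w', hw1', hwL', -, K', ρ', hK', hρ', hH'⟩ := hLl.exists_weight
  -- Halving makes the rate strictly smaller than `ρ'`, as the variation-of-constants integral
  -- needs. Both `μ` and `K'` are fixed before frames and trajectories are introduced.
  have hμ : 0 < min ρ ρ' / 2 := half_pos (lt_min hρ hρ')
  have hμρ : min ρ ρ' / 2 < ρ := (half_lt_self (lt_min hρ hρ')).trans_le (min_le_left _ _)
  have hμρ' : min ρ ρ' / 2 < ρ' := (half_lt_self (lt_min hρ hρ')).trans_le (min_le_right _ _)
  set μ := min ρ ρ' / 2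
  refine ⟨μ, K', hμ, hK', ?_⟩
  intro C hC pstar t₀ z hz hnot hind
  set q : Fin 2 → V → ℝ → FormationControl.E3 :=
    fun k i t => FormationControl.act (C i)⁻¹ (z k i t) with hq
  set qinf : Fin 2 → FormationControl.E3 := fun k => ∑ j, w j • q k j t₀ with hqinf
  have hLI : LinearIndependent ℝ ![qinf 0, qinf 1] := by
    rw [LinearIndependent.pair_iff'
      (FormationControl.weighted_sum_ne_zero_of_notMem_columnSpace hwuniq (hnot 0))]
    intro c hc
    refine FormationControl.weighted_sum_ne_zero_of_notMem_columnSpace hwuniq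
      (q := fun i => q 1 i t₀ - c • q 0 i t₀) (hind c) ?_
    simp only [smul_sub, Finset.sum_sub_distrib, smul_comm _ c, ← Finset.smul_sum]
    rw [sub_eq_zero]
    exact hc.symm
  have hqflow : ∀ k i t, t₀ ≤ t → q k i t =
      ∑ j, FormationControl.heatKernel (FormationControl.laplacian G a) (t - t₀) i j • q k j t₀ :=
    fun k i t ht => FormationControl.consensus_eq_heatKernel _ (x := q k)
      (fun j s hs => (FormationControl.hasDerivAt_aligned hloop hC hz k j hs).continuousWithinAt)
      (fun j s hs => (FormationControl.hasDerivAt_aligned hloop hC hz k j hs.le).hasDerivAt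
        (Ici_mem_nhds hs)) i ht
  have hqdecay : ∀ k i t, t₀ ≤ t →
      -- Summing over `k` gives a single constant for both auxiliary variables, as
      -- `exists_orientationEstimate_decay` expects.
      ‖q k i t - qinf k‖ ≤ (∑ k, K * ∑ j, ‖q k j t₀‖) * Real.exp (-ρ * (t - t₀)) := by
    intro k i t ht
    have e : q k i t - qinf k = ∑ j, (FormationControl.heatKernel
        (FormationControl.laplacian G a) (t - t₀) i j - w j) • q k j t₀ := by
      simp only [hqflow k i t ht, hqinf, sub_smul, Finset.sum_sub_distrib]
    rw [e]
    refine le_trans ?_ (mul_le_mul_of_nonneg_right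
      (Finset.single_le_sum (f := fun k => K * ∑ j, ‖q k j t₀‖) (fun k _ => by positivity)
        (Finset.mem_univ k)) (Real.exp_pos _).le)
    rw [mul_right_comm, Finset.mul_sum]
    refine (norm_sum_le _ _).trans (Finset.sum_le_sum fun j _ => ?_)
    rw [norm_smul, Real.norm_eq_abs]
    exact mul_le_mul_of_nonneg_right (hH _ (sub_nonneg.2 ht) i j) (norm_nonneg _)
  have hzq : ∀ k i t, z k i t = FormationControl.act (C i) (q k i t) := fun k i t =>
    (FormationControl.act_act_inv hC i _).symm
  have hOE : ∀ i t, FormationControl.orientationEstimate (z 0 i t) (z 1 i t)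
      = C i * FormationControl.orientationEstimate (q 0 i t) (q 1 i t) := fun i t => by
    rw [hzq, hzq, FormationControl.orientationEstimate_act (hC i)]
  set Cstar := FormationControl.orientationEstimate (qinf 0) (qinf 1)
  have hdecay := fun i => FormationControl.exists_orientationEstimate_decay hρ
    (hqdecay 0 i) (hqdecay 1 i) hLI
  refine ⟨Cstar, FormationControl.orientationEstimate_mem hLI, fun i => ?_, ?_⟩
  · have e : ∀ t, (C i)⁻¹ * FormationControl.orientationEstimate (z 0 i t) (z 1 i t)
        = FormationControl.orientationEstimate (q 0 i t) (q 1 i t) := fun t => by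
      rw [hOE, ← mul_assoc, FormationControl.rotation_inv_mul (hC i), one_mul]
    simp only [e]
    refine FormationControl.tendsto_matrix_of_act fun v => ?_
    obtain ⟨D, -, hD⟩ := hdecay i v
    exact FormationControl.tendsto_of_exp_decay hρ hD
  choose D hD0 hD using hdecay
  set Dtot : ℝ := ∑ i, ∑ j ∈ FormationControl.neighbors G i,
    ku * l i j * D i (pstar j - pstar i) with hDtot
  have hterm : ∀ i, 0 ≤ ∑ j ∈ FormationControl.neighbors G i,
      ku * l i j * D i (pstar j - pstar i) := fun i => Finset.sum_nonneg fun j hj =>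
    mul_nonneg (mul_pos hku (hl i j hj)).le (hD0 _ _)
  have hDtot0 : 0 ≤ Dtot := Finset.sum_nonneg fun i _ => hterm i
  refine ⟨((∑ j, |w' j|) / μ + Fintype.card V * K' / (ρ' - μ)) * Dtot,
    mul_nonneg (add_nonneg (by positivity)
      (div_nonneg (by positivity) (sub_nonneg.2 hμρ'.le))) hDtot0, ?_⟩
  rintro p ⟨hpc, hp⟩
  -- Off a countable set of instants all the estimates are defined.
  set S : Set ℝ := ⋃ i, {t | ¬ LinearIndependent ℝ ![
    ∑ j, FormationControl.heatKernel (FormationControl.laplacian G a) (t - t₀) i j • q 0 j t₀,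
    ∑ j, FormationControl.heatKernel (FormationControl.laplacian G a) (t - t₀) i j • q 1 j t₀]}
  have hS : S.Countable := by
    refine Set.countable_iUnion fun i => ?_
    -- The set `S` is built from the flow formula and not from `q`: the formula is analytic on the
    -- whole line, whereas `q` is governed by the law only from `t₀` on.
    have han : ∀ k c t, AnalyticAt ℝ (fun s => (∑ j, FormationControl.heatKernel
        (FormationControl.laplacian G a) (s - t₀) i j • q k j t₀) c) t := by
      intro k c t
      have : ∀ j, AnalyticAt ℝ (fun s => FormationControl.heatKernel
          (FormationControl.laplacian G a) (s - t₀) i j) t := fun j =>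
        AnalyticAt.comp (f := fun s : ℝ => s - t₀)
          (FormationControl.analyticAt_heatKernel_apply _ (t - t₀) i j) (by fun_prop)
      simp only [WithLp.ofLp_sum, WithLp.ofLp_smul, Finset.sum_apply, Pi.smul_apply, smul_eq_mul]
      exact Finset.analyticAt_fun_sum _ fun j _ => (this j).fun_mul analyticAt_const
    have hlim : ∀ k, Filter.Tendsto (fun s => ∑ j, FormationControl.heatKernel
        (FormationControl.laplacian G a) (s - t₀) i j • q k j t₀) Filter.atTop
        (nhds (qinf k)) := fun k =>
      (FormationControl.tendsto_of_exp_decay hρ (hqdecay k i)).congr'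
        ((Filter.eventually_ge_atTop t₀).mono fun s hs => hqflow k i s hs)
    exact FormationControl.countable_not_linearIndependent (han 0) (han 1) (hlim 0) (hlim 1) hLI
  obtain ⟨pinf, hpinf⟩ := FormationControl.perturbed_consensus (E := FormationControl.E3)
    (D := Dtot) hw1' hwL' hK'.le hμ hμρ'
    hLl.heatKernel_row_sum hH' hS (t₀ := t₀)
    (x := fun i t => p i t - FormationControl.act Cstar (pstar i))
    (d := fun i t => -∑ j ∈ FormationControl.neighbors G i, (ku * l i j) •
      (FormationControl.act (FormationControl.orientationEstimate (q 0 i t) (q 1 i t))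
        (pstar j - pstar i) - FormationControl.act Cstar (pstar j - pstar i)))
    (fun i => (hpc i).sub continuousOn_const)
    (fun i t ht htS => by
      have hqi : LinearIndependent ℝ ![q 0 i t, q 1 i t] := by
        by_contra hcon
        rw [hqflow 0 i t ht.le, hqflow 1 i t ht.le] at hcon
        exact htS (Set.mem_iUnion.2 ⟨i, hcon⟩)
      have hzi : LinearIndependent ℝ ![z 0 i t, z 1 i t] := by
        rw [hzq, hzq]
        exact FormationControl.linearIndependent_act (hC i) hqi
      have h := ((hp i t ht.le hzi).hasDerivAt (Ici_mem_nhds ht)).sub_const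
        (FormationControl.act Cstar (pstar i))
      rw [hOE, FormationControl.act_inv_localControl hloop l ku hC pstar _ Cstar] at h
      exact h)
    (fun i t ht => by
      rw [norm_neg]
      have h1 : Real.exp (-ρ * (t - t₀)) ≤ Real.exp (-μ * (t - t₀)) :=
        Real.exp_le_exp.2 (by nlinarith)
      calc _ ≤ ∑ j ∈ FormationControl.neighbors G i,
            ku * l i j * D i (pstar j - pstar i) * Real.exp (-ρ * (t - t₀)) := by
            refine norm_sum_le_of_le _ fun j hj => ?_
            rw [norm_smul, Real.norm_of_nonneg (mul_pos hku (hl i j hj)).le, mul_assoc _ (D _ _)]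
            exact mul_le_mul_of_nonneg_left (hD i _ t ht.le) (mul_pos hku (hl i j hj)).le
        _ = (∑ j ∈ FormationControl.neighbors G i,
            ku * l i j * D i (pstar j - pstar i)) * Real.exp (-ρ * (t - t₀)) :=
            (Finset.sum_mul _ _ _).symm
        _ ≤ Dtot * Real.exp (-μ * (t - t₀)) :=
            mul_le_mul (Finset.single_le_sum (f := fun i => ∑ j ∈ FormationControl.neighbors G i,
              ku * l i j * D i (pstar j - pstar i)) (fun i _ => hterm i) (Finset.mem_univ i))
              h1 (Real.exp_pos _).le hDtot0)
  refine ⟨pinf, fun i t ht => ?_⟩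
  simp only [← sub_sub]
  exact hpinf i t ht
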